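/- Let $N$ be a finite set of $n$ items and $M$ a finite set of agents, where every agent $\ell\in M$ has a valuation function $v_\ell:2^N\to\mathbb{R}_{+}$ that is normalized ($v_\ell(\emptyset)=0$), monotone ($v_\ell(S)\le v_\ell(T)$ for $S\subseteq T$) and submodular ($v_\ell(S\cup T)+v_\ell(S\cap T)\le v_\ell(S)+v_\ell(T)$ for all $S,T\subseteq N$). An allocation is a family $(A_\ell)_{\ell\in M}$ of pairwise disjoint subsets of $N$; its welfare is $\sum_{\ell\in M} v_\ell(A_\ell)$, and $\mathsf{OPT}$ is the maximum welfare of an allocation. In the online problem the items arrive one at a time, and each item is assigned irrevocably, on arrival, to one agent. The Greedy algorithm assigns the arriving item $j$ to an agent $\ell$ that maximizes the marginal gain $v_\ell(A_\ell\cup\{j\})-v_\ell(A_\ell)$, where $A_\ell$ is the set of items assigned to $\ell$ so far; ties may be broken in any way that depends only on the sequence of items that have arrived. Then Greedy has competitive ratio at least $0.5052$ in the random order model: if the $n$ items arrive in a uniformly random order, the expected welfare of the allocation produced by Greedy, averaged over all $n!$ arrival orders, is at least $0.5052\cdot\mathsf{OPT}$. -/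

import Mathlib

/-- The standing assumptions on a valuation function `f : 2^N → ℝ`: it is normalized, monotone and
submodular.  (Normalization and monotonicity make it non-negative.) -/
structure IsValuation {N : Type*} [DecidableEq N] (f : Finset N → ℝ) : Prop where
  empty : f ∅ = 0
  monotone : ∀ S T : Finset N, S ⊆ T → f S ≤ f T
  submodular : ∀ S T : Finset N, f (S ∪ T) + f (S ∩ T) ≤ f S + f T

/-- The bundles `A ℓ`, `ℓ : M`, form an allocation: every item is given to at most one agent
(items may stay unallocated). -/
def IsAllocation {N M : Type*} (A : M → Finset N) : Prop :=
  ∀ k l : M, k ≠ l → Disjoint (A k) (A l)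

/-- The social welfare `V(A) = ∑ ℓ, v ℓ (A ℓ)`. -/
noncomputable def welfare {N M : Type*} [Fintype M] (v : M → Finset N → ℝ)
    (A : M → Finset N) : ℝ :=
  ∑ l, v l (A l)

/-- The optimum (offline) social welfare, the largest welfare of an allocation. -/
noncomputable def optWelfare {N M : Type*} [Fintype M] (v : M → Finset N → ℝ) : ℝ :=
  sSup {w : ℝ | ∃ A : M → Finset N, IsAllocation A ∧ welfare v A = w}

/-- The supremum in `optWelfare` is a maximum. -/
theorem isGreatest_optWelfare {N M : Type*} [Fintype N] [Fintype M] (v : M → Finset N → ℝ) :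
    IsGreatest {w : ℝ | ∃ A : M → Finset N, IsAllocation A ∧ welfare v A = w}
      (optWelfare v) := by
  classical
  have hfin : {w : ℝ | ∃ A : M → Finset N, IsAllocation A ∧ welfare v A = w}.Finite :=
    (Set.finite_range (welfare v)).subset (by rintro _ ⟨A, -, rfl⟩; exact ⟨A, rfl⟩)
  have hne : {w : ℝ | ∃ A : M → Finset N, IsAllocation A ∧ welfare v A = w}.Nonempty :=
    ⟨_, fun _ => ∅, fun _ _ _ => Finset.disjoint_empty_left _, rfl⟩
  exact ⟨hne.csSup_mem hfin, fun _ hw => le_csSup hfin.bddAbove hw⟩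

/-- The bundles after agent `l` has received item `j` in addition to the bundles `A`. -/
def assign {N M : Type*} [DecidableEq N] [DecidableEq M] (A : M → Finset N) (j : N) (l : M) :
    M → Finset N :=
  Function.update A l (insert j (A l))

/-- The marginal gain of agent `l` for item `j` on top of the bundles `A`. -/
def marginalGain {N M : Type*} [DecidableEq N] (v : M → Finset N → ℝ) (A : M → Finset N)
    (j : N) (l : M) : ℝ :=
  v l (insert j (A l)) - v l (A l)

/-- An online assignment rule `c` maps the sequence `h` of the items that arrived so far and the
item `j` that arrives now to the agent `c h j` who receives `j`.  Sequences of arrived items are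
lists with the most recent item first.  `onlineAlloc c h` is the allocation that the rule has
produced once the items of `h` have arrived. -/
def onlineAlloc {N M : Type*} [DecidableEq N] [DecidableEq M] (c : List N → N → M) :
    List N → M → Finset N
  | [] => fun _ => ∅
  | j :: h => assign (onlineAlloc c h) j (c h j)

/-- The rule `c` is the Greedy algorithm (with some way of breaking ties): whatever distinct items
arrived before, a new item goes to an agent whose marginal gain for it is largest. -/
def IsGreedy {N M : Type*} [DecidableEq N] [DecidableEq M] (v : M → Finset N → ℝ)
    (c : List N → N → M) : Prop :=
  ∀ (h : List N) (j : N), h.Nodup → j ∉ h → ∀ l : M,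
    marginalGain v (onlineAlloc c h) j l ≤ marginalGain v (onlineAlloc c h) j (c h j)

/-- The welfare that the rule `c` achieves when the items arrive in the order
`π 0, π 1, …, π (n - 1)`. -/
noncomputable def onlineWelfare {N M : Type*} [Fintype N] [Fintype M] [DecidableEq N]
    [DecidableEq M] (v : M → Finset N → ℝ) (c : List N → N → M)
    (π : Fin (Fintype.card N) ≃ N) : ℝ :=
  welfare v (onlineAlloc c (List.ofFn π).reverse)

/-- The expected welfare of the rule `c` in the random order model: the average over all `n!`
arrival orders of the `n` items. -/
noncomputable def expectedWelfare {N M : Type*} [Fintype N] [Fintype M] [DecidableEq N]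
    [DecidableEq M] (v : M → Finset N → ℝ) (c : List N → N → M) : ℝ :=
  (∑ π : Fin (Fintype.card N) ≃ N, onlineWelfare v c π) / (Nat.factorial (Fintype.card N) : ℝ)

/-! Colour every item independently and uniformly with three colours, and let the colour classes
arrive one after the other, each in random order. The result is again a uniformly random order. Let
`a`, `b`, `g` be the expected welfare of Greedy after one, two and three classes, and `w` the
optimum.

`IsGreedy.three_blocks` compares the final bundles with the optimum and with the bundles that the
same rule would build from later classes alone. The classes are exchangeable, so the auxiliary terms
cancel on average and `8 g ≥ 2 w + 4 b + a` remains.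

`IsGreedy.card_mul_sub_totalWelfare_le` bounds the early welfare: with `k` of `n ≥ 2` items still to
come, Greedy has on average at least `(1 - k (k - 1) / (n (n - 1))) w / 2`. The quotient averages to
`4/9` after one class and to `1/9` after two, so `a ≥ 5/18 w` and `b ≥ 4/9 w`. Together, `g ≥ 73/144
w`, and `73/144 > 0.5069`. -/

/-- The part of the bundles `A` that consists of items of `S`. -/
def restrictBundles {N M : Type*} [DecidableEq N] (A : M → Finset N) (S : Finset N) :
    M → Finset N :=
  fun l => A l ∩ S

/-! ### Welfare on the lattice of bundles -/

section Bundles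

variable {N M : Type*} [DecidableEq N]

theorem restrictBundles_insert (A : M → Finset N) (j : N) (S : Finset N) :
    restrictBundles A (insert j S) = restrictBundles A S ⊔ restrictBundles A {j} := by
  funext l
  ext i
  simp only [restrictBundles, Pi.sup_apply, Finset.sup_eq_union, Finset.mem_inter,
    Finset.mem_union, Finset.mem_insert, Finset.mem_singleton]
  tauto

variable [Fintype M] {v : M → Finset N → ℝ}

theorem welfare_mono (hv : ∀ l, IsValuation (v l)) {A B : M → Finset N} (h : A ≤ B) :
    welfare v A ≤ welfare v B :=
  Finset.sum_le_sum fun l _ => (hv l).monotone _ _ (h l)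

theorem welfare_bot (hv : ∀ l, IsValuation (v l)) :
    welfare v (fun _ : M => (∅ : Finset N)) = 0 :=
  Finset.sum_eq_zero fun l _ => (hv l).empty

theorem welfare_nonneg (hv : ∀ l, IsValuation (v l)) (A : M → Finset N) : 0 ≤ welfare v A :=
  (welfare_bot hv).symm.le.trans (welfare_mono hv fun _ => Finset.empty_subset _)

/-- Submodularity of the welfare, combined with its monotonicity. -/
theorem welfare_add_le (hv : ∀ l, IsValuation (v l)) {A B C D : M → Finset N}
    (hCA : C ≤ A) (hCB : C ≤ B) (hD : D ≤ A ⊔ B) :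
    welfare v D + welfare v C ≤ welfare v A + welfare v B := by
  have h : welfare v (A ⊔ B) + welfare v (A ⊓ B) ≤ welfare v A + welfare v B := by
    simp only [welfare, ← Finset.sum_add_distrib]
    exact Finset.sum_le_sum fun l _ => (hv l).submodular _ _
  have h1 := welfare_mono hv hD
  have h2 := welfare_mono hv (le_inf hCA hCB)
  linarith

variable [DecidableEq M]

theorem welfare_assign (A : M → Finset N) (j : N) (l : M) :
    welfare v (assign A j l) = welfare v A + marginalGain v A j l := by
  simp only [welfare, assign, marginalGain]
  rw [← Finset.add_sum_erase _ _ (Finset.mem_univ l), ← Finset.add_sum_erase _ (fun k => v k (A k))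
    (Finset.mem_univ l), Function.update_self, Finset.sum_congr rfl fun k hk => by
      rw [Function.update_of_ne (Finset.ne_of_mem_erase hk)]]
  ring

end Bundles

/-! ### Online rules and the greedy inequalities -/

section OnlineRules

variable {N M : Type*} [DecidableEq N] [DecidableEq M] {c : List N → N → M}

theorem le_assign (A : M → Finset N) (j : N) (l : M) : A ≤ assign A j l := by
  intro k
  by_cases hk : k = l
  · subst hk
    simp [assign]
  · simp [assign, hk]

theorem onlineAlloc_le_append (c : List N → N → M) (h p : List N) :
    onlineAlloc c p ≤ onlineAlloc c (h ++ p) := by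
  induction h with
  | nil => exact le_rfl
  | cons j h ih => exact ih.trans (le_assign _ _ _)

theorem mem_onlineAlloc_append {h p : List N} {i : N} {l : M}
    (hi : i ∈ onlineAlloc c (h ++ p) l) : i ∈ h ∨ i ∈ onlineAlloc c p l := by
  induction h with
  | nil => exact Or.inr hi
  | cons j h ih =>
    by_cases hij : i = j
    · exact Or.inl (by simp [hij])
    · have : i ∈ onlineAlloc c (h ++ p) l := by
        rw [List.cons_append, onlineAlloc, assign] at hi
        by_cases hl : l = c (h ++ p) j
        · subst hl
          simpa [hij] using hi
        · simpa [hl] using hi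
      rcases ih this with h1 | h1
      · exact Or.inl (List.mem_cons_of_mem _ h1)
      · exact Or.inr h1

theorem mem_of_mem_onlineAlloc {h : List N} {i : N} {l : M} (hi : i ∈ onlineAlloc c h l) :
    i ∈ h := by
  rw [← List.append_nil h] at hi
  exact (mem_onlineAlloc_append hi).resolve_right (Finset.notMem_empty i)

theorem isAllocation_onlineAlloc (c : List N → N → M) {h : List N} (hn : h.Nodup) :
    IsAllocation (onlineAlloc c h) := by
  induction h with
  | nil => exact fun _ _ _ => Finset.disjoint_empty_left _
  | cons j h ih =>
    obtain ⟨hj, hn⟩ := List.nodup_cons.1 hn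
    have hj' : ∀ l, j ∉ onlineAlloc c h l := fun l hl => hj (mem_of_mem_onlineAlloc hl)
    intro k l hkl
    simp only [onlineAlloc, assign]
    by_cases hk : k = c h j
    · have hl : l ≠ c h j := fun hl => hkl (hk.trans hl.symm)
      subst hk
      rw [Function.update_self, Function.update_of_ne hl, Finset.disjoint_insert_left]
      exact ⟨hj' l, ih hn _ _ hkl⟩
    · rw [Function.update_of_ne hk]
      by_cases hl : l = c h j
      · subst hl
        rw [Function.update_self, Finset.disjoint_insert_right]
        exact ⟨hj' k, ih hn _ _ hkl⟩
      · rw [Function.update_of_ne hl]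
        exact ih hn _ _ hkl

variable [Fintype M] {v : M → Finset N → ℝ}

/-- Greedy gains at least as much from a new item as any allocation would on top of larger
bundles. -/
theorem IsGreedy.welfare_sup_singleton_le (hc : IsGreedy v c) (hv : ∀ l, IsValuation (v l))
    {h : List N} {j : N} (hn : h.Nodup) (hj : j ∉ h) {T B : M → Finset N} (hT : IsAllocation T)
    (hB : onlineAlloc c h ≤ B) :
    welfare v (B ⊔ restrictBundles T {j}) + welfare v (onlineAlloc c h) ≤
      welfare v B + welfare v (onlineAlloc c (j :: h)) := by
  have key : welfare v (onlineAlloc c h ⊔ restrictBundles T {j}) ≤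
      welfare v (onlineAlloc c (j :: h)) := by
    rw [onlineAlloc, welfare_assign]
    by_cases hl : ∃ l, j ∈ T l
    · obtain ⟨l, hl⟩ := hl
      have : onlineAlloc c h ⊔ restrictBundles T {j} = assign (onlineAlloc c h) j l := by
        funext k
        by_cases hk : k = l
        · subst hk
          ext i
          simp only [assign, restrictBundles, Pi.sup_apply, Finset.sup_eq_union,
            Function.update_self, Finset.mem_union, Finset.mem_inter, Finset.mem_singleton,
            Finset.mem_insert]
          constructor
          · tauto
          · rintro (rfl | hi)
            · exact Or.inr ⟨hl, rfl⟩
            · exact Or.inl hi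
        · have hjk : j ∉ T k := fun h' => Finset.disjoint_left.1 (hT k l hk) h' hl
          simp [assign, restrictBundles, hk, hjk]
      rw [this, welfare_assign]
      linarith [hc h j hn hj l]
    · have : onlineAlloc c h ⊔ restrictBundles T {j} = onlineAlloc c h := by
        funext k
        have hjk : j ∉ T k := fun h' => hl ⟨k, h'⟩
        simp [restrictBundles, hjk]
      rw [this, ← welfare_assign]
      exact welfare_mono hv (le_assign _ _ _)
  have := welfare_add_le hv (A := B) (B := onlineAlloc c h ⊔ restrictBundles T {j})
    (C := onlineAlloc c h) (D := B ⊔ restrictBundles T {j}) hB le_sup_left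
    (sup_le le_sup_left (le_sup_right.trans le_sup_right))
  linarith

/-- While the items of `h` arrive, Greedy gains at least as much as any allocation of these items
adds to larger bundles. -/
theorem IsGreedy.welfare_sup_le (hc : IsGreedy v c) (hv : ∀ l, IsValuation (v l))
    {h p : List N} (hn : (h ++ p).Nodup) {T B : M → Finset N} (hT : IsAllocation T)
    (hB : onlineAlloc c (h ++ p) ≤ B) :
    welfare v (B ⊔ restrictBundles T h.toFinset) + welfare v (onlineAlloc c p) ≤
      welfare v B + welfare v (onlineAlloc c (h ++ p)) := by
  induction h with
  | nil =>
    have : B ⊔ restrictBundles T ([] : List N).toFinset = B := by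
      funext k
      simp [restrictBundles]
    rw [this, List.nil_append]
  | cons j h ih =>
    rw [List.cons_append] at hn
    obtain ⟨hj, hn⟩ := List.nodup_cons.1 hn
    have hB' : onlineAlloc c (h ++ p) ≤ B := (le_assign _ _ _).trans hB
    have h1 := ih hn hB'
    have h2 := hc.welfare_sup_singleton_le hv hn hj hT
      (hB'.trans (le_sup_left (b := restrictBundles T h.toFinset)))
    rw [List.toFinset_cons, restrictBundles_insert, ← sup_assoc, List.cons_append]
    linarith

/-- Submodularity lets the items of `S` be added one by one, each gaining no more than Greedy would
gain from it right after `h`. -/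
theorem IsGreedy.welfare_sup_le_sum (hc : IsGreedy v c) (hv : ∀ l, IsValuation (v l))
    {h : List N} (hn : h.Nodup) {T B : M → Finset N} (hT : IsAllocation T)
    (hB : onlineAlloc c h ≤ B) (S : Finset N) (hS : ∀ i ∈ S, i ∉ h) :
    welfare v (B ⊔ restrictBundles T S) ≤ welfare v B +
      ∑ i ∈ S, (welfare v (onlineAlloc c (i :: h)) - welfare v (onlineAlloc c h)) := by
  induction S using Finset.induction_on with
  | empty =>
    have : B ⊔ restrictBundles T ∅ = B := by
      funext k
      simp [restrictBundles]
    simp [this]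
  | insert j S hj ih =>
    have h1 := ih fun i hi => hS i (Finset.mem_insert_of_mem hi)
    have h2 := hc.welfare_sup_singleton_le hv hn (hS j (Finset.mem_insert_self _ _)) hT
      (hB.trans (le_sup_left (b := restrictBundles T S)))
    rw [restrictBundles_insert, ← sup_assoc, Finset.sum_insert hj]
    linarith

/-- The gains that Greedy could make with the items that have not arrived yet make up for what it
still lacks to half the welfare of an allocation. -/
theorem IsGreedy.welfare_le_two_mul_add_sum [Fintype N] (hc : IsGreedy v c)
    (hv : ∀ l, IsValuation (v l)) {h : List N} (hn : h.Nodup) {T : M → Finset N}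
    (hT : IsAllocation T) :
    welfare v T ≤ 2 * welfare v (onlineAlloc c h) +
      ∑ i with i ∉ h, (welfare v (onlineAlloc c (i :: h)) - welfare v (onlineAlloc c h)) := by
  have h1 := hc.welfare_sup_le hv (p := []) (h := h) (by simpa using hn) hT (B := onlineAlloc c h)
    (by simp)
  have h2 := hc.welfare_sup_le_sum hv hn hT
    (le_sup_left (b := restrictBundles T h.toFinset)) {i | i ∉ h} (by simp)
  have h3 : T ≤ onlineAlloc c h ⊔ restrictBundles T h.toFinset ⊔
      restrictBundles T ({i | i ∉ h} : Finset N) := by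
    intro l i hi
    simp only [restrictBundles, Pi.sup_apply, Finset.sup_eq_union, Finset.mem_union,
      Finset.mem_inter, List.mem_toFinset, Finset.mem_filter, Finset.mem_univ, true_and]
    tauto
  have h4 := welfare_mono hv h3
  rw [List.append_nil] at h1
  have h5 : welfare v (onlineAlloc c []) = 0 := welfare_bot hv
  linarith

end OnlineRules

/-! ### The deterministic three-block inequality -/

section ThreeBlocks

variable {N M : Type*} [DecidableEq N] [DecidableEq M] [Fintype M] {c : List N → N → M}
  {v : M → Finset N → ℝ}

/-- The inequality between the runs of Greedy on the blocks `x`, `y`, `z` of a partition of the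
items.  The last four terms cancel on average over the orders of the blocks. -/
theorem IsGreedy.three_blocks (hc : IsGreedy v c) (hv : ∀ l, IsValuation (v l))
    {x y z : List N} (hn : (z ++ (y ++ x)).Nodup) (hmem : ∀ i, i ∈ x ∨ i ∈ y ∨ i ∈ z)
    {T : M → Finset N} (hT : IsAllocation T) :
    2 * welfare v T + 4 * welfare v (onlineAlloc c (y ++ x)) + welfare v (onlineAlloc c x) +
      (welfare v (onlineAlloc c x ⊔ onlineAlloc c z ⊔
        (restrictBundles T y.toFinset ⊔ restrictBundles T z.toFinset)) -
      welfare v (onlineAlloc c x ⊔ onlineAlloc c y ⊔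
        (restrictBundles T y.toFinset ⊔ restrictBundles T z.toFinset))) +
      (welfare v (onlineAlloc c x ⊔ onlineAlloc c (z ++ y) ⊔
        (restrictBundles T y.toFinset ⊔ restrictBundles T z.toFinset)) -
      welfare v (onlineAlloc c z ⊔ onlineAlloc c (y ++ x) ⊔
        (restrictBundles T x.toFinset ⊔ restrictBundles T y.toFinset))) ≤
      8 * welfare v (onlineAlloc c (z ++ (y ++ x))) := by
  have hyx : (y ++ x).Nodup := hn.of_append_right
  have hx : x.Nodup := hyx.of_append_right
  have hz : z.Nodup := hn.of_append_left
  have hzy : (z ++ y).Nodup := by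
    rw [← List.append_assoc] at hn
    exact hn.of_append_left
  have g1 := hc.welfare_sup_le hv (h := x) (p := []) (by simpa using hx) hT (le_of_eq rfl)
  have g2 := hc.welfare_sup_le hv hyx hT le_rfl
  have g3 := hc.welfare_sup_le hv hn hT le_rfl
  -- The competitor in `g4` and `g5` is what the rule builds from later blocks alone. Only its
  -- disjointness matters here; that it comes from the same rule is what makes terms cancel on
  -- average.
  have g4 := hc.welfare_sup_le hv hn (isAllocation_onlineAlloc c hzy) le_rfl
  have g5 := hc.welfare_sup_le hv hn (isAllocation_onlineAlloc c hz) le_rfl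
  have h0 : welfare v (onlineAlloc c []) = 0 := welfare_bot hv
  have hzz : restrictBundles (onlineAlloc c z) z.toFinset = onlineAlloc c z := by
    funext l
    exact Finset.inter_eq_left.2 fun i hi => List.mem_toFinset.2 (mem_of_mem_onlineAlloc hi)
  have hsplit : onlineAlloc c (z ++ y) ≤
      onlineAlloc c y ⊔ restrictBundles (onlineAlloc c (z ++ y)) z.toFinset := by
    intro l i hi
    rcases mem_onlineAlloc_append hi with h | h
    · exact Finset.mem_union_right _ (Finset.mem_inter.2 ⟨hi, List.mem_toFinset.2 h⟩)
    · exact Finset.mem_union_left _ h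
  have hcover : T ≤ restrictBundles T x.toFinset ⊔
      (restrictBundles T y.toFinset ⊔ restrictBundles T z.toFinset) := by
    intro l i hi
    simp only [restrictBundles, Pi.sup_apply, Finset.sup_eq_union, Finset.mem_union,
      Finset.mem_inter, List.mem_toFinset]
    have := hmem i
    tauto
  have hab : onlineAlloc c x ≤ onlineAlloc c (y ++ x) := onlineAlloc_le_append c _ _
  have hbc : onlineAlloc c (y ++ x) ≤ onlineAlloc c (z ++ (y ++ x)) := onlineAlloc_le_append c _ _
  rw [hzz] at g5
  rw [List.append_nil] at g1
  generalize restrictBundles (onlineAlloc c (z ++ y)) z.toFinset = E at *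
  generalize onlineAlloc c (z ++ y) = DE at *
  generalize onlineAlloc c (z ++ (y ++ x)) = ABC at *
  generalize onlineAlloc c (y ++ x) = AB at *
  generalize onlineAlloc c x = A at *
  generalize onlineAlloc c y = D at *
  generalize onlineAlloc c z = H at *
  generalize restrictBundles T x.toFinset = O1 at *
  generalize restrictBundles T y.toFinset = O2 at *
  generalize restrictBundles T z.toFinset = O3 at *
  -- With `h0`, the claim is the sum `g1 + 2 g2 + 3 g3 + g4 + g5 + s1 + ⋯ + s7`.
  have s1 := welfare_add_le hv (A := AB ⊔ O2) (B := ABC ⊔ O3) (C := AB) (D := ABC ⊔ (O2 ⊔ O3))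
    (by order) (by order) (by order)
  have s2 := welfare_add_le hv (A := AB ⊔ O2) (B := ABC ⊔ H) (C := AB) (D := ABC ⊔ H ⊔ O2)
    (by order) (by order) (by order)
  have s3 := welfare_add_le hv (A := ABC ⊔ O3) (B := ABC ⊔ H ⊔ O2) (C := ABC)
    (D := A ⊔ H ⊔ (O2 ⊔ O3)) (by order) (by order) (by order)
  have s4 := welfare_add_le hv (A := ABC ⊔ (O2 ⊔ O3)) (B := ABC ⊔ E) (C := ABC)
    (D := A ⊔ E ⊔ (O2 ⊔ O3)) (by order) (by order) (by order)
  have s5 := welfare_add_le hv (A := A ⊔ D ⊔ (O2 ⊔ O3)) (B := A ⊔ E ⊔ (O2 ⊔ O3))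
    (C := A ⊔ (O2 ⊔ O3)) (D := A ⊔ DE ⊔ (O2 ⊔ O3)) (by order) (by order) (by order)
  have s6 := welfare_add_le hv (A := ABC ⊔ O3) (B := H ⊔ AB ⊔ (O1 ⊔ O2)) (C := AB) (D := T)
    (by order) (by order) (by order)
  have s7 := welfare_add_le hv (A := A ⊔ O1) (B := A ⊔ (O2 ⊔ O3)) (C := A) (D := T)
    (by order) (by order) (by order)
  linarith

end ThreeBlocks

/-! ### Averaging over arrival orders -/

section RandomOrder

variable {N M : Type*} [Fintype N] [DecidableEq N] [DecidableEq M] [Fintype M]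
  {c : List N → N → M} {v : M → Finset N → ℝ}

/-- The welfare of the rule `c` on the sequence `e`, summed over all relabellings of the items. -/
noncomputable def totalWelfare (v : M → Finset N → ℝ) (c : List N → N → M) (e : List N) : ℝ :=
  ∑ σ : Equiv.Perm N, welfare v (onlineAlloc c (e.map σ))

/-- Relabelling a fixed enumeration of `N` yields each arrival order exactly once, so the choice of
enumeration is irrelevant. -/
theorem totalWelfare_eq_sum_onlineWelfare (v : M → Finset N → ℝ) (c : List N → N → M)
    {e : List N} (hn : e.Nodup) (he : ∀ i, i ∈ e) :
    totalWelfare v c e = ∑ π : Fin (Fintype.card N) ≃ N, onlineWelfare v c π := by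
  have hlen : e.reverse.length = Fintype.card N := by
    rw [← List.toFinset_card_of_nodup (List.nodup_reverse.2 hn), ← Finset.card_univ]
    congr 1
    ext i
    simp [he]
  let π₀ : Fin (Fintype.card N) ≃ N := (finCongr hlen.symm).trans
    (List.Nodup.getEquivOfForallMemList e.reverse (List.nodup_reverse.2 hn) (by simpa using he))
  have hπ₀ : List.ofFn π₀ = e.reverse := by
    apply List.ext_getElem
    · simpa using hlen.symm
    · intro i h1 h2
      simp [π₀, List.Nodup.getEquivOfForallMemList]
  refine Fintype.sum_equiv (Equiv.equivCongr π₀.symm (Equiv.refl N)) _ _ fun σ => ?_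
  have : List.ofFn (Equiv.equivCongr π₀.symm (Equiv.refl N) σ) = e.reverse.map σ := by
    rw [← hπ₀, List.map_ofFn]
    rfl
  rw [onlineWelfare, this, List.map_reverse, List.reverse_reverse]

theorem totalWelfare_cons_congr (v : M → Finset N → ℝ) (c : List N → N → M) {e : List N}
    {i j : N} (hi : i ∉ e) (hj : j ∉ e) :
    totalWelfare v c (i :: e) = totalWelfare v c (j :: e) := by
  refine Fintype.sum_equiv (Equiv.mulRight (Equiv.swap i j)) _ _ fun σ => ?_
  have : e.map (σ * Equiv.swap i j) = e.map σ := List.map_congr_left fun k hk => by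
    rw [Equiv.Perm.mul_apply, Equiv.swap_apply_of_ne_of_ne]
    · rintro rfl; exact hi hk
    · rintro rfl; exact hj hk
  rw [Equiv.coe_mulRight, List.map_cons, List.map_cons, this, Equiv.Perm.mul_apply,
    Equiv.swap_apply_right]

theorem totalWelfare_nil (hv : ∀ l, IsValuation (v l)) : totalWelfare v c [] = 0 :=
  Finset.sum_eq_zero fun _ _ => welfare_bot hv

theorem totalWelfare_le_cons (hv : ∀ l, IsValuation (v l)) (e : List N) (j : N) :
    totalWelfare v c e ≤ totalWelfare v c (j :: e) :=
  Finset.sum_le_sum fun _ _ => welfare_mono hv (le_assign _ _ _)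

/-- Under a random relabelling all unseen items are equally good as the next one, so the sum over
them in `IsGreedy.welfare_le_two_mul_add_sum` becomes a multiple of a single expected gain. -/
theorem IsGreedy.factorial_mul_welfare_le (hc : IsGreedy v c) (hv : ∀ l, IsValuation (v l))
    {e : List N} {j : N} (hn : e.Nodup) (hj : j ∉ e) {T : M → Finset N} (hT : IsAllocation T) :
    (Fintype.card N).factorial * welfare v T ≤ 2 * totalWelfare v c e +
      (Finset.card {i | i ∉ e} : ℝ) * (totalWelfare v c (j :: e) - totalWelfare v c e) := by
  have h1 : ∀ σ : Equiv.Perm N, welfare v T ≤ 2 * welfare v (onlineAlloc c (e.map σ)) +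
      ∑ i with i ∉ e, (welfare v (onlineAlloc c ((i :: e).map σ)) -
        welfare v (onlineAlloc c (e.map σ))) := fun σ => by
    refine (hc.welfare_le_two_mul_add_sum hv (hn.map σ.injective) hT).trans_eq ?_
    congr 1
    symm
    refine Finset.sum_equiv σ (fun i => ?_) fun i _ => by rw [List.map_cons]
    rw [Finset.mem_filter_univ, Finset.mem_filter_univ, List.mem_map_of_injective σ.injective]
  have h2 := Finset.sum_le_sum fun σ (_ : σ ∈ Finset.univ) => h1 σ
  rw [Finset.sum_const, Finset.card_univ, Fintype.card_perm, nsmul_eq_mul,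
    Finset.sum_add_distrib, ← Finset.mul_sum, Finset.sum_comm] at h2
  refine h2.trans_eq ?_
  rw [totalWelfare, ← nsmul_eq_mul, ← Finset.sum_const]
  congr 1
  refine Finset.sum_congr rfl fun i hi => ?_
  rw [Finset.sum_sub_distrib]
  change totalWelfare v c (i :: e) - totalWelfare v c e = _
  rw [totalWelfare_cons_congr v c (Finset.mem_filter.1 hi).2 hj]
  rfl

theorem card_notMem_cons {e : List N} {j : N} (hj : j ∉ e) :
    Finset.card {i | i ∉ e} = Finset.card {i | i ∉ j :: e} + 1 := by
  have : Finset.univ.filter (· ∉ e) = insert j (Finset.univ.filter (· ∉ j :: e)) := by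
    ext i
    simp only [Finset.mem_filter, Finset.mem_univ, true_and, Finset.mem_insert, List.mem_cons]
    by_cases hij : i = j
    · simp [hij, hj]
    · simp [hij]
  rw [this, Finset.card_insert_of_notMem (by simp)]

/-- When one of `k + 1` unseen items arrives, the deficit `w - 2 G` shrinks at least by the factor
`(k - 1) / (k + 1)`; the product of these factors telescopes. -/
theorem IsGreedy.card_mul_sub_totalWelfare_le (hc : IsGreedy v c) (hv : ∀ l, IsValuation (v l))
    {e : List N} (hn : e.Nodup) {T : M → Finset N} (hT : IsAllocation T) :
    (Fintype.card N * (Fintype.card N - 1) : ℝ) *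
        ((Fintype.card N).factorial * welfare v T - 2 * totalWelfare v c e) ≤
      (Finset.card {i | i ∉ e} * (Finset.card {i | i ∉ e} - 1) : ℝ) *
        ((Fintype.card N).factorial * welfare v T) := by
  have hw : 0 ≤ (Fintype.card N).factorial * welfare v T :=
    mul_nonneg (Nat.cast_nonneg _) (welfare_nonneg hv T)
  have hN : (0 : ℝ) ≤ Fintype.card N * (Fintype.card N - 1) := by
    rcases Nat.eq_zero_or_pos (Fintype.card N) with h | h
    · simp [h]
    · have : (1 : ℝ) ≤ Fintype.card N := by exact_mod_cast h
      exact mul_nonneg (by linarith) (by linarith)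
  induction e with
  | nil => simp [totalWelfare_nil hv]
  | cons j e ih =>
    obtain ⟨hj, hn⟩ := List.nodup_cons.1 hn
    have h1 := ih hn
    have h2 := hc.factorial_mul_welfare_le hv hn hj hT
    have h3 := totalWelfare_le_cons (c := c) hv e j
    rw [card_notMem_cons hj] at h1 h2
    push_cast at h1 h2
    generalize (Finset.card {i | i ∉ j :: e}) = k at *
    generalize ((Fintype.card N).factorial : ℝ) * welfare v T = w at *
    generalize totalWelfare v c (j :: e) = G' at *
    generalize totalWelfare v c e = G at *
    generalize (Fintype.card N * (Fintype.card N - 1) : ℝ) = m at *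
    -- For the last item the factor `k - 1` is negative and the induction hypothesis cannot be
    -- scaled by it; there `w ≤ G + G' ≤ 2 G'` suffices.
    rcases Nat.eq_zero_or_pos k with rfl | hk
    · have : w - 2 * G' ≤ 0 := by
        simp only [Nat.cast_zero, zero_add, one_mul] at h2
        linarith
      simpa using mul_nonpos_of_nonneg_of_nonpos hN this
    · have hk : (1 : ℝ) ≤ k := by exact_mod_cast hk
      have h4 : ((k : ℝ) + 1) * (w - 2 * G') ≤ (k - 1) * (w - 2 * G) := by linarith
      have h5 := mul_le_mul_of_nonneg_left h4 hN
      have h6 := mul_le_mul_of_nonneg_left h1 (sub_nonneg.2 hk)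
      refine le_of_mul_le_mul_left (?_ : ((k : ℝ) + 1) * _ ≤ (k + 1) * _) (by linarith)
      linarith

end RandomOrder

/-! ### Random colourings with three colours -/

section Colourings

variable {N : Type*} [Fintype N] [DecidableEq N]

/-- The product counts ordered pairs of distinct items with both colours in `S`; each pair has this
property with probability `(|S| / 3) ^ 2`. -/
theorem sum_card_mul_card_sub_one (S : Finset (Fin 3)) :
    9 * ∑ χ : N → Fin 3, (Finset.card {i | χ i ∈ S} * (Finset.card {i | χ i ∈ S} - 1) : ℝ) =
      (S.card : ℝ) ^ 2 * (Fintype.card N * (Fintype.card N - 1)) * 3 ^ Fintype.card N := by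
  have h1 : ∀ χ : N → Fin 3,
      (Finset.card {i | χ i ∈ S} * (Finset.card {i | χ i ∈ S} - 1) : ℝ) =
        ∑ p ∈ (Finset.univ : Finset N).offDiag, if χ p.1 ∈ S ∧ χ p.2 ∈ S then 1 else 0 := by
    intro χ
    have h : ({i | χ i ∈ S} : Finset N).offDiag =
        (Finset.univ : Finset N).offDiag.filter fun p => χ p.1 ∈ S ∧ χ p.2 ∈ S := by
      ext p
      simp only [Finset.mem_offDiag, Finset.mem_filter, Finset.mem_univ, true_and]
      tauto
    rw [Finset.sum_boole, ← h, Finset.offDiag_card, Nat.cast_sub (Nat.le_mul_self _)]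
    push_cast
    ring
  have h2 : ∀ p ∈ (Finset.univ : Finset N).offDiag,
      9 * ∑ χ : N → Fin 3, (if χ p.1 ∈ S ∧ χ p.2 ∈ S then (1 : ℝ) else 0) =
        (S.card : ℝ) ^ 2 * 3 ^ Fintype.card N := by
    rintro ⟨i, j⟩ hp
    have hij : i ≠ j := (Finset.mem_offDiag.1 hp).2.2
    have h : (Finset.univ.filter fun χ : N → Fin 3 => χ i ∈ S ∧ χ j ∈ S) =
        Fintype.piFinset fun k => if k ∈ ({i, j} : Finset N) then S else Finset.univ := by
      ext χ
      simp only [Finset.mem_filter, Finset.mem_univ, true_and, Fintype.mem_piFinset]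
      constructor
      · rintro ⟨h1, h2⟩ k
        split_ifs with hk
        · rcases Finset.mem_insert.1 hk with rfl | hk
          · exact h1
          · rwa [Finset.mem_singleton.1 hk]
        · exact Finset.mem_univ _
      · intro h
        have hi := h i
        have hj := h j
        simp at hi hj
        exact ⟨hi, hj⟩
    have hcard : ({i, j} : Finset N).card = 2 := Finset.card_pair hij
    rw [Finset.sum_boole, h, Fintype.card_piFinset]
    have : ∀ k : N, (if k ∈ ({i, j} : Finset N) then S else Finset.univ).card =
        if k ∈ ({i, j} : Finset N) then S.card else 3 := fun k => by split_ifs <;> simp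
    simp only [this]
    rw [Finset.prod_ite, Finset.prod_const, Finset.prod_const, Finset.filter_mem_eq_inter,
      Finset.univ_inter, hcard]
    have h3 := Finset.card_compl_add_card ({i, j} : Finset N)
    have h4 : (Finset.univ.filter fun k => k ∉ ({i, j} : Finset N)) = ({i, j} : Finset N)ᶜ := by
      ext k; simp
    rw [hcard] at h3
    rw [h4, ← h3, pow_add]
    push_cast
    ring
  simp only [h1]
  rw [Finset.sum_comm, Finset.mul_sum, Finset.sum_congr rfl h2, Finset.sum_const,
    Finset.offDiag_card, nsmul_eq_mul, Nat.cast_sub (Nat.le_mul_self _), Finset.card_univ]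
  push_cast
  ring

/-- The items of colour `k`, in the order in which they occur in `e`. -/
def colourBlock (e : List N) (χ : N → Fin 3) (k : Fin 3) : List N :=
  e.filter (χ · = k)

/-- Permuting the colours is a bijection of the colourings. This exchangeability cancels the
auxiliary terms of `IsGreedy.three_blocks`. -/
theorem sum_colourBlock_perm (e : List N) (τ : Equiv.Perm (Fin 3))
    (F : List N → List N → List N → ℝ) :
    ∑ χ : N → Fin 3, F (colourBlock e χ (τ 0)) (colourBlock e χ (τ 1)) (colourBlock e χ (τ 2)) =
      ∑ χ : N → Fin 3, F (colourBlock e χ 0) (colourBlock e χ 1) (colourBlock e χ 2) := by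
  refine Fintype.sum_equiv (Equiv.arrowCongr (Equiv.refl N) τ⁻¹) _ _ fun χ => ?_
  have : ∀ k, colourBlock e ((Equiv.arrowCongr (Equiv.refl N) τ⁻¹) χ) k =
      colourBlock e χ (τ k) := by
    intro k
    refine List.filter_congr fun i _ => ?_
    simp [Equiv.arrowCongr, Equiv.symm_apply_eq]
  simp only [this]

end Colourings

/-! ### The competitive ratio -/

theorem theorem1 {N M : Type*} [Fintype N] [Fintype M] [DecidableEq N] [DecidableEq M]
    (v : M → Finset N → ℝ) (hv : ∀ l, IsValuation (v l))
    (c : List N → N → M) (hc : IsGreedy v c) :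
    0.5052 * optWelfare v ≤ expectedWelfare v c := by
  obtain ⟨T, hT, hTw⟩ := (isGreatest_optWelfare v).1
  rw [← hTw, expectedWelfare, le_div_iff₀ (by positivity)]
  have hwT := welfare_nonneg hv T
  set w : ℝ := (Fintype.card N).factorial * welfare v T with hw
  have hw0 : 0 ≤ w := mul_nonneg (Nat.cast_nonneg _) hwT
  let e : List N := Finset.univ.toList
  have hn : e.Nodup := Finset.nodup_toList _
  have he : ∀ i, i ∈ e := by simp [e]
  set G := ∑ π : Fin (Fintype.card N) ≃ N, onlineWelfare v c π
  suffices h : 73 * w ≤ 144 * G by linarith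
  have hGe : ∀ e' : List N, e'.Nodup → (∀ i, i ∈ e') → totalWelfare v c e' = G :=
    fun e' => totalWelfare_eq_sum_onlineWelfare v c
  -- For fewer than two items `n (n - 1) = 0` and the early bound is void, but Greedy is optimal.
  rcases Nat.lt_or_ge (Fintype.card N) 2 with hN | hN
  · have hG0 : w ≤ G := by
      rcases isEmpty_or_nonempty N with hemp | ⟨⟨i⟩⟩
      · have : welfare v T = 0 := by
          rw [← welfare_bot hv]
          congr 1
          funext l
          exact Subsingleton.elim _ _
        rw [hw, this, mul_zero]
        exact Finset.sum_nonneg fun π _ => welfare_nonneg hv _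
      · have hsub : ∀ j : N, j = i := fun j =>
          Fintype.card_le_one_iff.1 (Nat.le_of_lt_succ hN) j i
        have h1 := hc.factorial_mul_welfare_le hv (e := []) (j := i) List.nodup_nil (by simp) hT
        have h2 : (Finset.card {j : N | j ∉ ([] : List N)} : ℝ) = 1 := by
          have : Fintype.card N = 1 := Fintype.card_eq_one_iff.2 ⟨i, hsub⟩
          simp [this]
        rw [h2, totalWelfare_nil hv, hGe [i] (List.nodup_singleton i) (by simp [hsub])] at h1
        linarith
    linarith
  have hm : (0 : ℝ) < Fintype.card N * (Fintype.card N - 1) := by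
    have : (2 : ℝ) ≤ Fintype.card N := by exact_mod_cast hN
    exact mul_pos (by linarith) (by linarith)
  have hmem : ∀ χ i, i ∈ colourBlock e χ 0 ∨ i ∈ colourBlock e χ 1 ∨ i ∈ colourBlock e χ 2 := by
    intro χ i
    simp only [colourBlock, List.mem_filter, he, true_and, decide_eq_true_eq]
    generalize χ i = k
    fin_cases k <;> simp
  have hnb : ∀ χ k, (colourBlock e χ k).Nodup := fun χ k => hn.filter _
  have hdisj : ∀ χ k l, k ≠ l → (colourBlock e χ k).Disjoint (colourBlock e χ l) := by
    intro χ k l hkl i hi hj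
    simp only [colourBlock, List.mem_filter, decide_eq_true_eq] at hi hj
    exact hkl (hi.2.symm.trans hj.2)
  have hn2 : ∀ χ, (colourBlock e χ 1 ++ colourBlock e χ 0).Nodup := fun χ =>
    List.nodup_append'.2 ⟨hnb χ 1, hnb χ 0, hdisj χ 1 0 (by decide)⟩
  have hn3 : ∀ χ, (colourBlock e χ 2 ++ (colourBlock e χ 1 ++ colourBlock e χ 0)).Nodup :=
    fun χ => List.nodup_append'.2 ⟨hnb χ 2, hn2 χ,
      List.disjoint_append_right.2 ⟨hdisj χ 2 1 (by decide), hdisj χ 2 0 (by decide)⟩⟩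
  have hfull : ∀ χ, totalWelfare v c
      (colourBlock e χ 2 ++ (colourBlock e χ 1 ++ colourBlock e χ 0)) = G := fun χ =>
    hGe _ (hn3 χ) fun i => by
      have := hmem χ i
      simp only [List.mem_append]
      tauto
  have hχ : ((Fintype.card (N → Fin 3) : ℕ) : ℝ) = 3 ^ Fintype.card N := by simp
  -- Here `S` is the set of colours still to come.
  have early : ∀ (S : Finset (Fin 3)) (f : (N → Fin 3) → List N), (∀ χ, (f χ).Nodup) →
      (∀ χ i, i ∉ f χ ↔ χ i ∈ S) →
      (9 - (S.card : ℝ) ^ 2) * (3 ^ Fintype.card N * w) ≤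
        18 * ∑ χ, totalWelfare v c (f χ) := by
    intro S f hf hS
    have h1 := Finset.sum_le_sum fun χ (_ : χ ∈ Finset.univ) =>
      hc.card_mul_sub_totalWelfare_le hv (hf χ) hT
    simp only [hS] at h1
    rw [← Finset.mul_sum, ← Finset.sum_mul, Finset.sum_sub_distrib, Finset.sum_const,
      Finset.card_univ, nsmul_eq_mul, hχ, ← Finset.mul_sum, ← hw] at h1
    have h2 := sum_card_mul_card_sub_one (N := N) S
    generalize (Fintype.card N * (Fintype.card N - 1) : ℝ) = m at *
    refine le_of_mul_le_mul_left (?_ : m * _ ≤ m * _) hm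
    have h3 := congrArg (· * w) h2
    linarith
  have early1 := early {1, 2} (fun χ => colourBlock e χ 0) (fun χ => hnb χ 0) fun χ i => by
    simp only [colourBlock, List.mem_filter, he, true_and, decide_eq_true_eq]
    generalize χ i = k
    fin_cases k <;> simp
  have early2 := early {2} (fun χ => colourBlock e χ 1 ++ colourBlock e χ 0) hn2 fun χ i => by
    simp only [colourBlock, List.mem_append, List.mem_filter, he, true_and, decide_eq_true_eq]
    generalize χ i = k
    fin_cases k <;> simp
  have blocks : ∀ σ : Equiv.Perm N, 2 * (3 ^ Fintype.card N * welfare v T) +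
      4 * ∑ χ, welfare v (onlineAlloc c ((colourBlock e χ 1 ++ colourBlock e χ 0).map σ)) +
      ∑ χ, welfare v (onlineAlloc c ((colourBlock e χ 0).map σ)) ≤
      8 * ∑ χ, welfare v (onlineAlloc c
        ((colourBlock e χ 2 ++ (colourBlock e χ 1 ++ colourBlock e χ 0)).map σ)) := by
    intro σ
    have h1 := Finset.sum_le_sum fun χ (_ : χ ∈ Finset.univ) =>
      hc.three_blocks hv (x := (colourBlock e χ 0).map σ) (y := (colourBlock e χ 1).map σ)
        (z := (colourBlock e χ 2).map σ)
        (by simpa only [List.map_append] using (hn3 χ).map σ.injective)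
        (fun i => by
          obtain ⟨j, rfl⟩ := σ.surjective i
          simpa only [List.mem_map_of_injective σ.injective] using hmem χ j) hT
    simp only [Finset.sum_add_distrib, Finset.sum_sub_distrib, ← Finset.mul_sum,
      Finset.sum_const, Finset.card_univ, nsmul_eq_mul, hχ, ← List.map_append] at h1
    -- `e1` exchanges the last two blocks; `e2` rotates all three.
    have e1 := sum_colourBlock_perm e (Equiv.swap 1 2) fun x y z =>
      welfare v (onlineAlloc c (x.map σ) ⊔ onlineAlloc c (y.map σ) ⊔
        (restrictBundles T (y.map σ).toFinset ⊔ restrictBundles T (z.map σ).toFinset))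
    have e2 := sum_colourBlock_perm e (finRotate 3) fun x y z =>
      welfare v (onlineAlloc c (z.map σ) ⊔ onlineAlloc c ((y ++ x).map σ) ⊔
        (restrictBundles T (x.map σ).toFinset ⊔ restrictBundles T (y.map σ).toFinset))
    have p1 : (Equiv.swap 1 2 : Equiv.Perm (Fin 3)) 0 = 0 := by decide
    have p2 : (Equiv.swap 1 2 : Equiv.Perm (Fin 3)) 1 = 2 := by decide
    have p3 : (Equiv.swap 1 2 : Equiv.Perm (Fin 3)) 2 = 1 := by decide
    have p4 : finRotate 3 0 = 1 := by decide
    have p5 : finRotate 3 1 = 2 := by decide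
    have p6 : finRotate 3 2 = 0 := by decide
    simp only [p1, p2, p3, sup_comm (restrictBundles T (List.map σ (colourBlock e _ 2)).toFinset)]
      at e1
    simp only [p4, p5, p6] at e2
    linarith
  have total := Finset.sum_le_sum fun σ (_ : σ ∈ Finset.univ) => blocks σ
  simp only [Finset.sum_add_distrib, ← Finset.mul_sum, Finset.sum_const, Finset.card_univ,
    Fintype.card_perm, nsmul_eq_mul] at total
  rw [Finset.sum_comm (s := Finset.univ (α := Equiv.Perm N)),
    Finset.sum_comm (s := Finset.univ (α := Equiv.Perm N)),
    Finset.sum_comm (s := Finset.univ (α := Equiv.Perm N))] at total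
  change 2 * _ + 4 * ∑ χ, totalWelfare v c (colourBlock e χ 1 ++ colourBlock e χ 0) +
    ∑ χ, totalWelfare v c (colourBlock e χ 0) ≤ 8 * ∑ χ, totalWelfare v c
      (colourBlock e χ 2 ++ (colourBlock e χ 1 ++ colourBlock e χ 0)) at total
  simp only [hfull, Finset.sum_const, Finset.card_univ, nsmul_eq_mul, hχ, ← hw] at total
  have hc1 : ((({1, 2} : Finset (Fin 3)).card : ℕ) : ℝ) = 2 := by
    rw [Finset.card_pair (by decide)]
    norm_num
  have hc2 : ((({2} : Finset (Fin 3)).card : ℕ) : ℝ) = 1 := by norm_num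
  rw [hc1] at early1
  rw [hc2] at early2
  have hpow : (0 : ℝ) < 3 ^ Fintype.card N := by positivity
  refine le_of_mul_le_mul_left (?_ : (3 : ℝ) ^ Fintype.card N * _ ≤ 3 ^ Fintype.card N * _) hpow
  linarith
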